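/- Let $R$ be a finite commutative ring with unity, and let $L(R)$ be the set of nonzero zero divisors of $R$, that is, of the elements $x \neq 0$ of $R$ such that $xy = 0$ for some $y \neq 0$ in $R$. Let $Z(R)$ be the zero-divisor graph of $R$: its vertex set is $L(R)$, and two distinct vertices $x, y$ are adjacent if and only if $xy = 0$. Suppose that $|L(R)| \geq 3$, that $Z(R)$ has a cut vertex (that is, $Z(R)$ is connected and has a vertex whose removal leaves two or more connected components), and that $Z(R)$ has no vertex of degree $1$. Then $Mdim(Z(R)) = \infty$. Here, for a finite connected graph $G$ and $B \subseteq V(G)$, the multiset representation of a vertex $v$ with respect to $B$ is the multiset $\{d(v,b) : b \in B\}$ of distances, counted with multiplicity; $B$ is a multiset resolving set of $G$ if any two distinct vertices of $G$ have different multiset representations with respect to $B$; and $Mdim(G)$ is the least cardinality of a multiset resolving set of $G$, with $Mdim(G) = \infty$ if $G$ has none. -/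

import Mathlib

/-- The set `L(R)` of nonzero zero divisors of a commutative ring `R`; these are the vertices of
the zero-divisor graph. -/
def nonzeroZeroDivisors (R : Type*) [CommRing R] : Set R :=
  {x | x ≠ 0 ∧ ∃ y : R, y ≠ 0 ∧ x * y = 0}

/-- The zero-divisor graph `Z(R)`: its vertices are the nonzero zero divisors of `R`, and two
distinct vertices are adjacent when their product is zero. -/
def zeroDivisorGraph (R : Type*) [CommRing R] : SimpleGraph (nonzeroZeroDivisors R) where
  Adj x y := x ≠ y ∧ (x : R) * (y : R) = 0
  symm := ⟨fun x y h => ⟨h.1.symm, by rw [mul_comm]; exact h.2⟩⟩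
  loopless := ⟨fun _ h => h.1 rfl⟩

namespace SimpleGraph

variable {V : Type*}

/-- `v` is a cut vertex of the connected graph `G`: deleting `v` leaves at least two connected
components. -/
def IsCutVertex (G : SimpleGraph V) (v : V) : Prop :=
  G.Connected ∧ ¬ (G.induce {v}ᶜ).Preconnected

/-- The multiset representation of `v` with respect to `B`: the multiset of the distances from `v`
to the vertices of `B`, with multiplicities. -/
noncomputable def multisetRep (G : SimpleGraph V) (B : Finset V) (v : V) : Multiset ℕ :=
  B.val.map (fun b => G.dist v b)

/-- `B` is a multiset resolving set: distinct vertices of `G`, inside or outside `B`, have distinct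
multiset representations with respect to `B`. -/
def IsMultisetResolving (G : SimpleGraph V) (B : Finset V) : Prop :=
  ∀ u v : V, u ≠ v → G.multisetRep B u ≠ G.multisetRep B v

/-- The multiset dimension of a finite connected graph: the least cardinality of a multiset
resolving set, and `⊤` if there is none. -/
noncomputable def multisetDim (G : SimpleGraph V) : ℕ∞ :=
  sInf {n : ℕ∞ | ∃ B : Finset V, G.IsMultisetResolving B ∧ (B.card : ℕ∞) = n}

end SimpleGraph

/-! In a graph of diameter at most two, the multiset representation of a vertex of `B` with respect
to `B` is determined by its degree in the subgraph induced on `B`. Some two vertices of that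
subgraph have the same degree, so no `B` with two or more elements is resolving, and without leaves
no smaller `B` is resolving either.

A zero-divisor graph without leaves has diameter at most two as soon as it has a cut vertex `x`,
because `x` is then adjacent to every other vertex: if `p p' = 0` and `u u' = 0`, with `p`, `p'` and
`u`, `u'` in different components of the graph deprived of `x`, then `p' u` annihilates both `p` and
`u'`, so `p' u = x`, and therefore `x p = 0`. -/

section Graph

variable {V : Type*} {G : SimpleGraph V}

/-- Otherwise every degree from `0` to `card V - 1` occurs, so that an isolated vertex and a
universal one coexist. -/
theorem exists_ne_degree_eq_degree [Fintype V] [Nontrivial V] (G : SimpleGraph V)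
    [DecidableRel G.Adj] : ∃ u v, u ≠ v ∧ G.degree u = G.degree v := by
  by_contra! hne
  let f : V → Fin (Fintype.card V) := fun v => ⟨G.degree v, G.degree_lt_card_verts v⟩
  have hf : f.Injective := fun u v huv => by_contra fun h => hne u v h (congrArg Fin.val huv)
  have hsurj := (hf.bijective_of_nat_card_le (by simp)).surjective
  have hcard : 0 < Fintype.card V := Fintype.card_pos
  obtain ⟨a, ha⟩ := hsurj ⟨0, hcard⟩
  obtain ⟨z, hz⟩ := hsurj ⟨Fintype.card V - 1, by omega⟩
  have isolated : G.IsIsolated a := (G.degree_eq_zero a).1 (congrArg Fin.val ha)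
  have universal : G.IsUniversal z :=
    (G.degree_eq_card_sub_one z).1 (congrArg Fin.val hz)
  exact isolated.not_isUniversal z universal

theorem exists_ne_card_filter_adj_eq (G : SimpleGraph V) [DecidableRel G.Adj] {B : Finset V}
    (hB : 1 < B.card) : ∃ u ∈ B, ∃ v ∈ B, u ≠ v ∧
      (B.filter (G.Adj u)).card = (B.filter (G.Adj v)).card := by
  have : Nontrivial B := (Finset.one_lt_card_iff_nontrivial.1 hB).coe_sort
  have hdegree (u : B) : (G.comap ((↑) : B → V)).degree u = (B.filter (G.Adj u)).card := by
    rw [← SimpleGraph.card_neighborFinset_eq_degree,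
      ← Finset.card_map (Function.Embedding.subtype (· ∈ B))]
    congr 1
    ext b
    simp [and_comm]
  obtain ⟨u, v, huv, h⟩ := exists_ne_degree_eq_degree (G.comap ((↑) : B → V))
  exact ⟨u, u.2, v, v.2, Subtype.coe_injective.ne huv, by rwa [hdegree, hdegree] at h⟩

theorem dist_eq_two_of_ediam_le_two (hG : G.ediam ≤ 2) {u v : V} (huv : u ≠ v)
    (hadj : ¬ G.Adj u v) : G.dist u v = 2 := by
  have hreach : G.Reachable u v :=
    G.preconnected_of_ediam_ne_top (ne_top_of_le_ne_top (by simp) hG) u v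
  have hle : (G.dist u v : ℕ∞) ≤ 2 :=
    hreach.coe_dist_eq_edist.trans_le (SimpleGraph.edist_le_ediam.trans hG)
  exact le_antisymm (by exact_mod_cast hle) (hreach.one_lt_dist_of_ne_of_not_adj huv hadj)

theorem multisetRep_eq_of_ediam_le_two [DecidableRel G.Adj] (hG : G.ediam ≤ 2) {B : Finset V}
    {u : V} (hu : u ∈ B) :
    G.multisetRep B u = 0 ::ₘ (Multiset.replicate (B.filter (G.Adj u)).card 1 +
      Multiset.replicate (B.card - 1 - (B.filter (G.Adj u)).card) 2) := by
  classical
  have herase : B.filter (G.Adj u) = (B.erase u).filter (G.Adj u) := by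
    ext b
    simp only [Finset.mem_filter, Finset.mem_erase]
    exact ⟨fun h => ⟨⟨h.2.ne', h.1⟩, h.2⟩, fun h => ⟨h.1.2, h.2⟩⟩
  have hcard :
      ((B.erase u).filter (¬ G.Adj u ·)).card = B.card - 1 - (B.filter (G.Adj u)).card := by
    rw [herase, ← Finset.card_erase_of_mem hu,
      ← Finset.card_filter_add_card_filter_not (s := B.erase u) (G.Adj u), Nat.add_sub_cancel_left]
  have hadj : ((B.erase u).filter (G.Adj u)).val.map (G.dist u) =
      Multiset.replicate (B.filter (G.Adj u)).card 1 := by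
    rw [herase]
    refine (Multiset.map_congr rfl fun b hb => ?_).trans (Multiset.map_const' _ 1)
    exact SimpleGraph.dist_eq_one_iff_adj.2 (Finset.mem_filter.1 hb).2
  have hnadj : ((B.erase u).filter (¬ G.Adj u ·)).val.map (G.dist u) =
      Multiset.replicate (B.card - 1 - (B.filter (G.Adj u)).card) 2 := by
    rw [← hcard]
    refine (Multiset.map_congr rfl fun b hb => ?_).trans (Multiset.map_const' _ 2)
    obtain ⟨hbB, hb⟩ := Finset.mem_filter.1 hb
    exact dist_eq_two_of_ediam_le_two hG (Finset.ne_of_mem_erase hbB).symm hb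
  calc G.multisetRep B u = (u ::ₘ (B.erase u).val).map (G.dist u) := by
        rw [Finset.erase_val, Multiset.cons_erase hu, SimpleGraph.multisetRep]
    _ = 0 ::ₘ (B.erase u).val.map (G.dist u) := by
        rw [Multiset.map_cons, SimpleGraph.dist_self]
    _ = _ := by
        rw [← hadj, ← hnadj, ← Multiset.map_add, Finset.filter_val, Finset.filter_val,
          Multiset.filter_add_not]

theorem exists_adj_ne_of_ncard_neighborSet_ne_one [Nontrivial V] (hG : G.Preconnected) {v : V}
    (hv : (G.neighborSet v).ncard ≠ 1) (x : V) : ∃ w, G.Adj v w ∧ w ≠ x := by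
  obtain ⟨u, hu⟩ := hG.exists_adj_of_nontrivial v
  by_contra! h
  exact hv (Set.ncard_eq_one.2 ⟨x, Set.eq_singleton_iff_nonempty_unique_mem.2 ⟨⟨u, hu⟩, h⟩⟩)

/-- Any two neighbours of `b` have the same multiset representation with respect to `{b}`. -/
theorem one_lt_card_of_isMultisetResolving [Nontrivial V] (hG : G.Preconnected)
    (hdeg : ∀ v, (G.neighborSet v).ncard ≠ 1) {B : Finset V} (hB : G.IsMultisetResolving B) :
    1 < B.card := by
  by_contra! hcard
  obtain ⟨b, hb⟩ := Finset.card_le_one_iff_subset_singleton.1 hcard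
  obtain ⟨s, hs, -⟩ := exists_adj_ne_of_ncard_neighborSet_ne_one hG (hdeg b) b
  obtain ⟨t, ht, hts⟩ := exists_adj_ne_of_ncard_neighborSet_ne_one hG (hdeg b) s
  refine hB t s hts (Multiset.map_congr rfl fun c hc => ?_)
  obtain rfl := Finset.mem_singleton.1 (hb hc)
  rw [SimpleGraph.dist_eq_one_iff_adj.2 ht.symm, SimpleGraph.dist_eq_one_iff_adj.2 hs.symm]

theorem not_isMultisetResolving_of_ediam_le_two (hG : G.ediam ≤ 2) {B : Finset V}
    (hcard : 1 < B.card) : ¬ G.IsMultisetResolving B := by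
  classical
  obtain ⟨u, hu, v, hv, huv, hadj⟩ := exists_ne_card_filter_adj_eq G hcard
  intro hB
  refine hB u v huv ?_
  rw [multisetRep_eq_of_ediam_le_two hG hu, multisetRep_eq_of_ediam_le_two hG hv, hadj]

theorem multisetDim_eq_top_of_ediam_le_two [Nontrivial V] (hG : G.ediam ≤ 2)
    (hdeg : ∀ v, (G.neighborSet v).ncard ≠ 1) : G.multisetDim = ⊤ := by
  have hconn : G.Preconnected :=
    G.preconnected_of_ediam_ne_top (ne_top_of_le_ne_top (by simp) hG)
  refine sInf_eq_top.2 ?_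
  rintro _ ⟨B, hB, -⟩
  have hcard := one_lt_card_of_isMultisetResolving hconn hdeg hB
  exact absurd hB (not_isMultisetResolving_of_ediam_le_two hG hcard)

theorem ediam_le_two_of_isUniversal {v : V} (hv : G.IsUniversal v) : G.ediam ≤ 2 :=
  calc G.ediam ≤ 2 * G.eccent v := G.ediam_le_two_mul_eccent v
    _ ≤ 2 * 1 := by gcongr; exact (G.eccent_le_one_iff v).2 fun _ hw => hv hw
    _ = 2 := mul_one 2

theorem nontrivial_of_isCutVertex {v : V} (hv : G.IsCutVertex v) : Nontrivial V := by
  by_contra h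
  have : Subsingleton V := not_nontrivial_iff_subsingleton.1 h
  exact hv.2 .of_subsingleton

end Graph

/-- The nonzero zero divisors of a commutative monoid with zero. For a commutative ring this unfolds
to `nonzeroZeroDivisors`. -/
def monoidZeroDivisors (M : Type*) [CommMonoidWithZero M] : Set M :=
  {x | x ≠ 0 ∧ ∃ y : M, y ≠ 0 ∧ x * y = 0}

/-- The zero-divisor graph of a commutative monoid with zero, on the vertex set
`monoidZeroDivisors M`. For a commutative ring it unfolds to `zeroDivisorGraph`. -/
def monoidZeroDivisorGraph (M : Type*) [CommMonoidWithZero M] :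
    SimpleGraph (monoidZeroDivisors M) where
  Adj x y := x ≠ y ∧ (x : M) * (y : M) = 0
  symm := ⟨fun _ _ h => ⟨h.1.symm, (mul_comm _ _).trans h.2⟩⟩
  loopless := ⟨fun _ h => h.1 rfl⟩

section ZeroDivisors

variable {M : Type*} [CommMonoidWithZero M] {x : monoidZeroDivisors M}

theorem reachable_induce_compl_of_mul_eq_zero {p q : ({x}ᶜ : Set (monoidZeroDivisors M))}
    (hpq : (p : M) * q = 0) : ((monoidZeroDivisorGraph M).induce {x}ᶜ).Reachable p q := by
  obtain rfl | hne := eq_or_ne p q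
  · exact .refl p
  · exact SimpleGraph.Adj.reachable ⟨Subtype.coe_injective.ne hne, hpq⟩

/-- The product `p * q` annihilates both `p'` and `q'`, so as a vertex other than `x` it would join
`p` to `q`. -/
theorem mul_eq_of_not_reachable_induce_compl {p q p' q' : ({x}ᶜ : Set (monoidZeroDivisors M))}
    (hpq : ¬ ((monoidZeroDivisorGraph M).induce {x}ᶜ).Reachable p q)
    (hp : (p : M) * p' = 0) (hq : (q : M) * q' = 0) : (p : M) * q = x := by
  by_contra hne
  have hp' : (p : M) * q * p' = 0 := by rw [mul_right_comm, hp, zero_mul]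
  have hq' : (p : M) * q * q' = 0 := by rw [mul_assoc, hq, mul_zero]
  have hpq0 : (p : M) * q ≠ 0 := fun h => hpq (reachable_induce_compl_of_mul_eq_zero h)
  let r : ({x}ᶜ : Set (monoidZeroDivisors M)) :=
    ⟨⟨p * q, hpq0, p', p'.1.2.1, hp'⟩, fun h => hne (congrArg Subtype.val h)⟩
  have hpr := (reachable_induce_compl_of_mul_eq_zero hp).trans
    (reachable_induce_compl_of_mul_eq_zero (p := r) hp').symm
  have hrq := (reachable_induce_compl_of_mul_eq_zero (p := r) hq').trans
    (reachable_induce_compl_of_mul_eq_zero hq).symm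
  exact hpq (hpr.trans hrq)

theorem isUniversal_of_isCutVertex (hx : (monoidZeroDivisorGraph M).IsCutVertex x)
    (hdeg : ∀ v, ((monoidZeroDivisorGraph M).neighborSet v).ncard ≠ 1) :
    (monoidZeroDivisorGraph M).IsUniversal x := by
  intro p hxp
  have := nontrivial_of_isCutVertex hx
  obtain ⟨hconn, hcut⟩ := hx
  have exists_neighbor (v) : ∃ w, (monoidZeroDivisorGraph M).Adj v w ∧ w ≠ x :=
    exists_adj_ne_of_ncard_neighborSet_ne_one hconn.preconnected (hdeg v) x
  obtain ⟨p', hpp', hp'x⟩ := exists_neighbor p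
  obtain ⟨u, hu⟩ :
      ∃ u, ¬ ((monoidZeroDivisorGraph M).induce {x}ᶜ).Reachable ⟨p', hp'x⟩ u := by
    by_contra! h
    exact hcut fun v w => (h v).symm.trans (h w)
  obtain ⟨u', huu', hu'x⟩ := exists_neighbor u
  have hp'u : (p' : M) * u = x := mul_eq_of_not_reachable_induce_compl (p' := ⟨p, hxp.symm⟩)
    (q' := ⟨u', hu'x⟩) hu ((mul_comm _ _).trans hpp'.2) huu'.2
  refine ⟨hxp, ?_⟩
  rw [← hp'u, mul_comm, ← mul_assoc, hpp'.2, zero_mul]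

end ZeroDivisors

theorem corollary3p1_general (M : Type*) [CommMonoidWithZero M]
    (hcut : ∃ v, (monoidZeroDivisorGraph M).IsCutVertex v)
    (hdeg : ∀ v, ((monoidZeroDivisorGraph M).neighborSet v).ncard ≠ 1) :
    (monoidZeroDivisorGraph M).multisetDim = ⊤ := by
  obtain ⟨x, hx⟩ := hcut
  have := nontrivial_of_isCutVertex hx
  have hdiam := ediam_le_two_of_isUniversal (isUniversal_of_isCutVertex hx hdeg)
  exact multisetDim_eq_top_of_ediam_le_two hdiam hdeg

theorem corollary3p1 (R : Type*) [CommRing R] [Finite R]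
    (hcard : 3 ≤ (nonzeroZeroDivisors R).ncard)
    (hcut : ∃ v, (zeroDivisorGraph R).IsCutVertex v)
    (hdeg : ∀ v, ((zeroDivisorGraph R).neighborSet v).ncard ≠ 1) :
    (zeroDivisorGraph R).multisetDim = ⊤ :=
  corollary3p1_general R hcut hdeg
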